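/- Let $R$ be a complete discrete valuation ring with normalized valuation $v$ and fraction field $K$ of characteristic different from $2$ (the residue field is arbitrary). Fix an integer $a \geq 2$ and equip $R$ with the canonical norm $|x|_a = a^{v(x)}$ for $x \neq 0$, $|0|_a = 0$, extended multiplicatively to $K$ by $|x/y|_a = |x|_a/|y|_a$. Let $q \in R[x_1,\ldots,x_n]$ be a quadratic form (a homogeneous polynomial of degree $2$) that is nondegenerate over $K$. Then the following are equivalent: (i) $q$ is Euclidean for $|\cdot|_a$: for all $x \in K^n \setminus R^n$ there exists $y \in R^n$ such that $0 < |q(x-y)|_a < 1$. (ii) The quadratic $R$-lattice $R^n$ in the quadratic space $(K^n, q)$ is maximal: it is not strictly contained in any other quadratic $R$-lattice, where a quadratic $R$-lattice in $(K^n,q)$ is a finitely generated $R$-submodule $\Lambda \subset K^n$ that spans $K^n$ over $K$ and satisfies $q(\Lambda) \subset R$. -/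

import Mathlib

namespace EuclideanForms

/-- A norm on a commutative ring `R`: a function `R → ℕ` with `|x| = 0 ↔ x = 0`,
`|xy| = |x||y|`, and `|x| = 1 ↔ x` is a unit. -/
structure ElementNorm (R : Type*) [CommRing R] where
  toFun : R → ℕ
  eq_zero_iff' : ∀ x, toFun x = 0 ↔ x = 0
  map_mul' : ∀ x y, toFun (x * y) = toFun x * toFun y
  eq_one_iff' : ∀ x, toFun x = 1 ↔ IsUnit x

/-- The extension of a norm from the domain `R` to its fraction field `K`, with values in `ℚ`:
`|r / s| = |r| / |s|`. -/
noncomputable def ElementNorm.frac {R : Type*} [CommRing R] (N : ElementNorm R)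
    {K : Type*} [Field K] [Algebra R K] [IsFractionRing R K] (x : K) : ℚ :=
  (N.toFun (IsLocalization.sec (nonZeroDivisors R) x).1 : ℚ) /
    (N.toFun (IsLocalization.sec (nonZeroDivisors R) x).2 : ℚ)

/-- The value of the extended norm does not depend on the fraction that represents the element. -/
theorem ElementNorm.frac_div {R : Type*} [CommRing R] [IsDomain R] (N : ElementNorm R)
    {K : Type*} [Field K] [Algebra R K] [IsFractionRing R K] (r s : R) (hs : s ≠ 0) :
    N.frac (algebraMap R K r / algebraMap R K s) = (N.toFun r : ℚ) / (N.toFun s : ℚ) := by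
  unfold ElementNorm.frac
  set p := IsLocalization.sec (nonZeroDivisors R) (algebraMap R K r / algebraMap R K s) with hp
  have hp2 : (p.2 : R) ≠ 0 := nonZeroDivisors.ne_zero p.2.2
  have h := IsLocalization.sec_spec (nonZeroDivisors R)
    (algebraMap R K r / algebraMap R K s)
  rw [← hp] at h
  have hsK : algebraMap R K s ≠ 0 := by
    simpa using (IsFractionRing.injective R K).ne hs
  have h2 : r * (p.2 : R) = p.1 * s := by
    apply IsFractionRing.injective R K
    rw [map_mul, map_mul, ← h]
    field_simp
  have h3 := congrArg N.toFun h2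
  rw [N.map_mul', N.map_mul'] at h3
  have e1 : (N.toFun (p.2 : R) : ℚ) ≠ 0 := by
    exact_mod_cast fun h0 => hp2 ((N.eq_zero_iff' _).1 h0)
  have e2 : (N.toFun s : ℚ) ≠ 0 := by
    exact_mod_cast fun h0 => hs ((N.eq_zero_iff' _).1 h0)
  rw [div_eq_div_iff e1 e2]
  exact_mod_cast h3.symm

open Classical in
/-- The canonical norm `|x|_a = a ^ v(x)` (`x ≠ 0`), `|0|_a = 0`, of a discrete valuation ring with
normalized valuation `v`, for an integer `a ≥ 2`. -/
noncomputable def dvrNorm (R : Type*) [CommRing R] [IsDomain R] [IsDiscreteValuationRing R]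
    (a : ℕ) (ha : 2 ≤ a) : ElementNorm R where
  toFun x := if x = 0 then 0 else a ^ (IsDiscreteValuationRing.addVal R x).toNat
  eq_zero_iff' x := by
    by_cases hx : x = 0
    · simp [hx]
    · simp only [hx, if_false, iff_false]
      positivity
  map_mul' x y := by
    by_cases hx : x = 0
    · simp [hx]
    by_cases hy : y = 0
    · simp [hy]
    have hx' : IsDiscreteValuationRing.addVal R x ≠ ⊤ := by
      simpa [IsDiscreteValuationRing.addVal_eq_top_iff] using hx
    have hy' : IsDiscreteValuationRing.addVal R y ≠ ⊤ := by
      simpa [IsDiscreteValuationRing.addVal_eq_top_iff] using hy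
    rw [if_neg hx, if_neg hy, if_neg (mul_ne_zero hx hy), IsDiscreteValuationRing.addVal_mul,
      ENat.toNat_add hx' hy', pow_add]
  eq_one_iff' x := by
    by_cases hx : x = 0
    · simp [hx]
    have hx' : IsDiscreteValuationRing.addVal R x ≠ ⊤ := by
      simpa [IsDiscreteValuationRing.addVal_eq_top_iff] using hx
    rw [if_neg hx, isUnit_iff_dvd_one, ← IsDiscreteValuationRing.addVal_le_iff_dvd,
      IsDiscreteValuationRing.addVal_one, Nat.pow_eq_one]
    simp only [show a ≠ 1 by omega, false_or, ENat.toNat_eq_zero, hx', or_false, nonpos_iff_eq_zero]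

/-- A homogeneous polynomial of degree `2` over `R` induces a quadratic form on `K ^ n`. -/
theorem exists_quadraticForm {R : Type*} [CommRing R] (K : Type*) [Field K] [Algebra R K] {n : ℕ}
    (q : MvPolynomial (Fin n) R) (hq : q.IsHomogeneous 2) :
    ∃ Q : QuadraticForm K (Fin n → K), ∀ x, Q x = MvPolynomial.aeval x q := by
  have lin : ∀ p ∈ MvPolynomial.homogeneousSubmodule (Fin n) R 1,
      ∃ f : (Fin n → K) →ₗ[K] K, ∀ x, f x = MvPolynomial.aeval x p := by
    intro p hp
    rw [MvPolynomial.homogeneousSubmodule_one_eq_span_X] at hp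
    induction hp using Submodule.span_induction with
    | mem p hp =>
      obtain ⟨i, rfl⟩ := hp
      exact ⟨LinearMap.proj i, fun x => by simp⟩
    | zero => exact ⟨0, fun x => by simp⟩
    | add p p' _ _ h h' =>
      obtain ⟨f, hf⟩ := h
      obtain ⟨f', hf'⟩ := h'
      exact ⟨f + f', fun x => by simp [hf, hf']⟩
    | smul r p _ h =>
      obtain ⟨f, hf⟩ := h
      exact ⟨algebraMap R K r • f, fun x => by simp [hf, Algebra.smul_def]⟩
  have hq' : q ∈ MvPolynomial.homogeneousSubmodule (Fin n) R 2 := hq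
  rw [← MvPolynomial.homogeneousSubmodule_one_pow, pow_two] at hq'
  clear hq
  induction hq' using Submodule.mul_induction_on' with
  | mem_mul_mem p hp p' hp' =>
    obtain ⟨f, hf⟩ := lin p hp
    obtain ⟨f', hf'⟩ := lin p' hp'
    exact ⟨QuadraticMap.linMulLin f f', fun x => by simp [hf, hf']⟩
  | add p _ p' _ h h' =>
    obtain ⟨Q, hQ⟩ := h
    obtain ⟨Q', hQ'⟩ := h'
    exact ⟨Q + Q', fun x => by simp [hQ, hQ']⟩

/-- The quadratic form `x ↦ q(x)` on `K ^ n` attached to a homogeneous polynomial `q` of degree `2`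
in `n` variables over `R`. -/
noncomputable def formOver {R : Type*} [CommRing R] (K : Type*) [Field K] [Algebra R K] {n : ℕ}
    (q : MvPolynomial (Fin n) R) (hq : q.IsHomogeneous 2) : QuadraticForm K (Fin n → K) where
  toFun x := MvPolynomial.aeval x q
  toFun_smul c x := by
    obtain ⟨Q, hQ⟩ := exists_quadraticForm K q hq
    rw [← hQ, ← hQ, QuadraticMap.map_smul]
  exists_companion' := by
    obtain ⟨Q, hQ⟩ := exists_quadraticForm K q hq
    obtain ⟨B, hB⟩ := Q.exists_companion
    exact ⟨B, fun x y => by rw [← hQ, ← hQ, ← hQ, hB]⟩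

/-- The standard lattice `R ^ n` inside `K ^ n`. -/
def stdLattice (R K : Type*) [CommRing R] [Field K] [Algebra R K] (n : ℕ) :
    Submodule R (Fin n → K) :=
  LinearMap.range ((Algebra.linearMap R K).compLeft (Fin n))

/-- `q` is Euclidean for the norm `N`: for all `x ∈ K ^ n` outside `R ^ n` there is `y ∈ R ^ n` with
`0 < |q(x - y)| < 1`. -/
def IsEuclideanForm {R : Type*} [CommRing R] (K : Type*) [Field K] [Algebra R K]
    [IsFractionRing R K] (N : ElementNorm R) {n : ℕ} (q : MvPolynomial (Fin n) R) : Prop :=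
  ∀ x : Fin n → K, x ∉ stdLattice R K n →
    ∃ y ∈ stdLattice R K n,
      0 < N.frac (MvPolynomial.aeval (x - y) q) ∧ N.frac (MvPolynomial.aeval (x - y) q) < 1

/-- A quadratic `R`-lattice in the quadratic space `(V, Q)` over `K`: a finitely generated
`R`-submodule that spans `V` over `K` and on which `Q` takes values in `R`. -/
def IsQuadraticLattice {R K V : Type*} [CommRing R] [Field K] [Algebra R K]
    [AddCommGroup V] [Module K V] [Module R V] [IsScalarTower R K V]
    (Q : QuadraticForm K V) (L : Submodule R V) : Prop :=
  Submodule.IsLattice K L ∧ ∀ x ∈ L, Q x ∈ (algebraMap R K).range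

/-- A quadratic lattice is maximal if it is not strictly contained in another quadratic lattice of
the same quadratic space. -/
def IsMaximalQuadraticLattice {R K V : Type*} [CommRing R] [Field K] [Algebra R K]
    [AddCommGroup V] [Module K V] [Module R V] [IsScalarTower R K V]
    (Q : QuadraticForm K V) (L : Submodule R V) : Prop :=
  Maximal (IsQuadraticLattice (R := R) Q) L

end EuclideanForms

namespace EuclideanForms

section

variable {R : Type*} [CommRing R] {K : Type*} [Field K] [Algebra R K]

/-! A nonzero `z` in `K` has norm `a ^ v(z)`, so `0 < |z| < 1` says exactly that `z ∉ R`
(`dvrNorm_frac_pos_and_lt_one_iff`). Hence `q` is Euclidean iff every coset of `R ^ n` other than `R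
^ n` itself contains a vector with non-integral value. If a quadratic lattice `L ⊇ R ^ n` had a
point `x ∉ R ^ n`, the whole coset of `x` would lie in `L` and take integral values, so a Euclidean
form has maximal standard lattice. Conversely, if `q` is integral on the coset of `x ∉ R ^ n`, then
so are the polar values of `x` against `R ^ n`, and `R ^ n + R x` is a strictly larger quadratic
lattice (`IsQuadraticLattice.sup_span_singleton`). -/

theorem ElementNorm.frac_algebraMap [IsDomain R] [IsFractionRing R K] (N : ElementNorm R) (r : R) :
    N.frac (algebraMap R K r) = N.toFun r := by
  have h := N.frac_div (K := K) r 1 one_ne_zero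
  rwa [map_one, div_one, (N.eq_one_iff' 1).2 isUnit_one, Nat.cast_one, div_one] at h

/-- An element of `K` at which the extension of a norm lies strictly between `0` and `1` is not
integral. -/
theorem ElementNorm.notMem_range_of_frac [IsDomain R] [IsFractionRing R K] (N : ElementNorm R)
    {z : K} (h0 : 0 < N.frac z) (h1 : N.frac z < 1) : z ∉ (algebraMap R K).range := by
  rintro ⟨r, rfl⟩
  rw [N.frac_algebraMap] at h0 h1
  norm_cast at h0 h1
  -- The norm of an element of `R` is a natural number, and none lies strictly between 0 and 1.
  omega

/-- Divisibility in a discrete valuation ring is comparison of valuations, hence total: if `s ∤ r`,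
then `v(r) < v(s)`. -/
theorem dvrNorm_lt_of_not_dvd [IsDomain R] [IsDiscreteValuationRing R] {a : ℕ} (ha : 2 ≤ a)
    {r s : R} (hs : s ≠ 0) (h : ¬ s ∣ r) : (dvrNorm R a ha).toFun r < (dvrNorm R a ha).toFun s := by
  have hr : r ≠ 0 := by
    rintro rfl
    exact h (dvd_zero s)
  rw [← IsDiscreteValuationRing.addVal_le_iff_dvd, not_le] at h
  simp only [dvrNorm, hr, hs, if_false]
  refine Nat.pow_lt_pow_right (by omega) ?_
  -- `toNat` sends `⊤` to 0, so it preserves the inequality only because both valuations are finite.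
  have hs' : IsDiscreteValuationRing.addVal R s ≠ ⊤ := by
    simpa [IsDiscreteValuationRing.addVal_eq_top_iff] using hs
  rwa [← ENat.natCast_lt_natCast, ENat.natCast_toNat h.ne_top, ENat.natCast_toNat hs']

/-- For the canonical norm of a discrete valuation ring, the elements of norm strictly between `0`
and `1` are exactly the non-integral ones. -/
theorem dvrNorm_frac_pos_and_lt_one_iff [IsDomain R] [IsDiscreteValuationRing R]
    [IsFractionRing R K] {a : ℕ} (ha : 2 ≤ a) (z : K) :
    (0 < (dvrNorm R a ha).frac z ∧ (dvrNorm R a ha).frac z < 1) ↔ z ∉ (algebraMap R K).range := by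
  refine ⟨fun h => (dvrNorm R a ha).notMem_range_of_frac h.1 h.2, fun hz => ?_⟩
  obtain ⟨r, s, hs, rfl⟩ := IsFractionRing.div_surjective (A := R) z
  have hs0 : s ≠ 0 := nonZeroDivisors.ne_zero hs
  have hsK : algebraMap R K s ≠ 0 := by
    simpa using (IsFractionRing.injective R K).ne hs0
  have hsr : ¬ s ∣ r := by
    rintro ⟨t, rfl⟩
    exact hz ⟨t, by rw [map_mul, mul_div_cancel_left₀ _ hsK]⟩
  have hr0 : r ≠ 0 := by
    rintro rfl
    exact hsr (dvd_zero s)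
  have hposr : 0 < (dvrNorm R a ha).toFun r :=
    Nat.pos_of_ne_zero fun h => hr0 (((dvrNorm R a ha).eq_zero_iff' r).1 h)
  have hlt := dvrNorm_lt_of_not_dvd ha hs0 hsr
  have hpos : (0 : ℚ) < (dvrNorm R a ha).toFun s := by exact_mod_cast hposr.trans hlt
  rw [ElementNorm.frac_div _ _ _ hs0, div_lt_one hpos]
  exact ⟨div_pos (by exact_mod_cast hposr) hpos, by exact_mod_cast hlt⟩

theorem mem_stdLattice {n : ℕ} {x : Fin n → K} :
    x ∈ stdLattice R K n ↔ ∀ i, x i ∈ (algebraMap R K).range := by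
  constructor
  · rintro ⟨y, rfl⟩ i
    exact ⟨y i, rfl⟩
  · intro h
    choose y hy using h
    exact ⟨y, funext hy⟩

theorem stdLattice_isLattice (n : ℕ) : Submodule.IsLattice K (stdLattice R K n) where
  fg := by
    rw [stdLattice, LinearMap.range_eq_map]
    exact Module.Finite.fg_top.map _
  span_eq_top := by
    rw [eq_top_iff, ← (Pi.basisFun K (Fin n)).span_eq]
    refine Submodule.span_mono ?_
    rintro _ ⟨i, rfl⟩
    refine mem_stdLattice.2 fun j => ?_
    rw [Pi.basisFun_apply, Pi.single_apply]
    split_ifs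
    exacts [one_mem _, zero_mem _]

theorem aeval_mem_range_of_mem_stdLattice {n : ℕ} (q : MvPolynomial (Fin n) R) {x : Fin n → K}
    (hx : x ∈ stdLattice R K n) : MvPolynomial.aeval x q ∈ (algebraMap R K).range := by
  obtain ⟨y, rfl⟩ := hx
  exact ⟨MvPolynomial.aeval y q, (MvPolynomial.aeval_algebraMap_apply K y q).symm⟩

theorem stdLattice_isQuadraticLattice {n : ℕ} (q : MvPolynomial (Fin n) R)
    (hq : q.IsHomogeneous 2) : IsQuadraticLattice (formOver K q hq) (stdLattice R K n) :=
  ⟨stdLattice_isLattice n, fun _ hx => aeval_mem_range_of_mem_stdLattice q hx⟩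

/-- If `Q` is integral on the coset `x + L` of a quadratic lattice `L`, then `L + R x` is again a
quadratic lattice. -/
theorem IsQuadraticLattice.sup_span_singleton {V : Type*} [AddCommGroup V] [Module K V]
    [Module R V] [IsScalarTower R K V] {Q : QuadraticForm K V} {L : Submodule R V}
    (hL : IsQuadraticLattice Q L) {x : V} (hx : ∀ y ∈ L, Q (x - y) ∈ (algebraMap R K).range) :
    IsQuadraticLattice Q (L ⊔ R ∙ x) := by
  have hLat := hL.1
  have hQx : Q x ∈ (algebraMap R K).range := by simpa using hx 0 L.zero_mem
  have hpolar : ∀ y ∈ L, QuadraticMap.polar Q x y ∈ (algebraMap R K).range := by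
    intro y hy
    -- The polar value is `Q (x + y) - Q x - Q y`, and `x + y = x - (-y)` lies in the coset.
    have h := hx (-y) (L.neg_mem hy)
    rw [sub_neg_eq_add] at h
    exact sub_mem (sub_mem h hQx) (hL.2 y hy)
  refine ⟨⟨hLat.fg.sup (Submodule.fg_span_singleton x), ?_⟩, ?_⟩
  · rw [eq_top_iff, ← hLat.span_eq_top]
    exact Submodule.span_mono (show L ≤ L ⊔ R ∙ x from le_sup_left)
  · intro z hz
    obtain ⟨y, hy, w, hw, rfl⟩ := Submodule.mem_sup.1 hz
    obtain ⟨r, rfl⟩ := Submodule.mem_span_singleton.1 hw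
    -- `Q (y + r x) = Q y + r² Q x + r · polar Q x y`, with every term integral.
    rw [QuadraticMap.map_add Q, ← algebraMap_smul K r x, QuadraticMap.map_smul,
      QuadraticMap.polar_smul_right, QuadraticMap.polar_comm]
    have hr : algebraMap R K r ∈ (algebraMap R K).range := ⟨r, rfl⟩
    exact add_mem (add_mem (hL.2 y hy) (mul_mem (mul_mem hr hr) hQx))
      (mul_mem hr (hpolar y hy))

/-- The standard lattice of a Euclidean form is maximal, for an arbitrary norm on a domain. -/
theorem IsEuclideanForm.isMaximalQuadraticLattice [IsDomain R] [IsFractionRing R K]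
    {N : ElementNorm R} {n : ℕ} {q : MvPolynomial (Fin n) R} (h : IsEuclideanForm K N q)
    (hq : q.IsHomogeneous 2) :
    IsMaximalQuadraticLattice (formOver K q hq) (stdLattice R K n) := by
  refine ⟨stdLattice_isQuadraticLattice q hq, fun L hL hle x hx => ?_⟩
  by_contra hxR
  obtain ⟨y, hy, h0, h1⟩ := h x hxR
  exact N.notMem_range_of_frac h0 h1 (hL.2 _ (L.sub_mem hx (hle hy)))

/-- Outside a maximal quadratic lattice, every coset contains a vector with non-integral value. -/
theorem IsMaximalQuadraticLattice.exists_notMem_range {V : Type*} [AddCommGroup V] [Module K V]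
    [Module R V] [IsScalarTower R K V] {Q : QuadraticForm K V} {L : Submodule R V}
    (hL : IsMaximalQuadraticLattice Q L) {x : V} (hx : x ∉ L) :
    ∃ y ∈ L, Q (x - y) ∉ (algebraMap R K).range := by
  by_contra! h
  -- Maximality forces `L + R x ≤ L`, which puts `x` in `L`.
  exact hx (hL.le_of_ge (IsQuadraticLattice.sup_span_singleton hL.prop h) le_sup_left
    (Submodule.mem_sup_right (Submodule.mem_span_singleton_self x)))

end

end EuclideanForms

theorem theorem19 {R : Type*} [CommRing R] [IsDomain R] [IsDiscreteValuationRing R]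
    [IsAdicComplete (IsLocalRing.maximalIdeal R) R]
    {K : Type*} [Field K] [Algebra R K] [IsFractionRing R K] (h2 : (2 : K) ≠ 0)
    (a : ℕ) (ha : 2 ≤ a)
    (n : ℕ) (q : MvPolynomial (Fin n) R) (hq : q.IsHomogeneous 2)
    (hnd : (QuadraticMap.polarBilin (EuclideanForms.formOver K q hq)).Nondegenerate) :
    EuclideanForms.IsEuclideanForm K (EuclideanForms.dvrNorm R a ha) q ↔
      EuclideanForms.IsMaximalQuadraticLattice (EuclideanForms.formOver K q hq)
        (EuclideanForms.stdLattice R K n) := by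
  refine ⟨fun h => h.isMaximalQuadraticLattice hq, fun h x hx => ?_⟩
  obtain ⟨y, hy, hxy⟩ := h.exists_notMem_range hx
  exact ⟨y, hy, (EuclideanForms.dvrNorm_frac_pos_and_lt_one_iff ha _).2 hxy⟩
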